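/- Let $k$ be a field of characteristic zero and let $K\ge 3$ be an integer. For integers $M,N$ let \[ IT(M,N)=\mathrm{conv}\{(0,0),(M+N,KN),(M,0)\},\qquad RT(M,N)=\mathrm{conv}\{(0,0),(M,M+N),(M-\tfrac{M+N}{K},0)\}, \] and let $\tau(M,N)=(N,(K-1)N-(M+N))$. Let $\xi^{int}_{M,N}$ (respectively $\xi^{rat}_{M,N}$) denote the polynomial $f\in k[x,y]$ with constant term $1$, all of whose monomials $x^ay^b$ satisfy $(a,b)\in IT(M,N)$ (respectively $(a,b)\in RT(M,N)$), and which vanishes to order at least $M+N$ (respectively at least $M$) at the point $(1,1)$. Let $\varepsilon^{int}_{M,N}$ be the coefficient of $x^{M+N}y^{KN}$ in $\xi^{int}_{M,N}$, and $\varepsilon^{rat}_{M,N}$ the coefficient of $x^My^{M+N}$ in $\xi^{rat}_{M,N}$. Let $M,N\ge 0$ be integers with $(M+N)^2=KMN+1$. If $M>0$, then $\xi^{int}_{M,N}$, $\xi^{rat}_{M,N}$ and $\xi^{rat}_{\tau(M,N)}$ exist and are unique, and \[ \xi^{int}_{M,N}=\xi^{rat}_{M,N}\,\xi^{rat}_{\tau(M,N)}-\varepsilon^{rat}_{M,N}\,x^M(y-1)^{M+N}.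 \tag{1} \] If $N>0$, then $\xi^{int}_{M,N}$, $\xi^{int}_{\tau(M,N)}$ and $\xi^{rat}_{\tau(M,N)}$ exist and are unique, and \[ \big(\xi^{rat}_{\tau(M,N)}\big)^K=\xi^{int}_{M,N}\,\xi^{int}_{\tau(M,N)}-\varepsilon^{int}_{M,N}\,x^{M+N}(y-1)^{KN}. \tag{2} \] Moreover, given the coefficients $\varepsilon^{int}_{M,N}$ and $\varepsilon^{rat}_{M,N}$, these relations determine the polynomials with $M>N$ inductively: $\xi^{int}_{1,0}=1-x$ and $\xi^{rat}_{1,0}=1-xy$, and any two families of polynomials $F_{M,N},G_{M,N}\in k[x,y]$ with $F_{1,0}=1-x$, $G_{1,0}=1-xy$ that satisfy (1) and (2), with $F,G$ in place of $\xi^{int},\xi^{rat}$ and with the same coefficients $\varepsilon$, for all solutions $M>N>0$ of $(M+N)^2=KMN+1$, satisfy $F_{M,N}=\xi^{int}_{M,N}$ and $G_{M,N}=\xi^{rat}_{M,N}$ for all solutions $M>N\ge 0$. -/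

import Mathlib

open MvPolynomial

noncomputable section

/-- The integral triangle with vertices `(0,0)`, `(M+N, K N)`, `(M, 0)`, where `p = (M, N)`. -/
def IT (K : ℕ) (p : ℤ × ℤ) : Set (ℝ × ℝ) :=
  convexHull ℝ {((0 : ℝ), (0 : ℝ)), ((p.1 : ℝ) + p.2, (K : ℝ) * p.2), ((p.1 : ℝ), (0 : ℝ))}

/-- The rational triangle with vertices `(0,0)`, `(M, M+N)`, `(M - (M+N)/K, 0)`,
where `p = (M, N)`. -/
def RT (K : ℕ) (p : ℤ × ℤ) : Set (ℝ × ℝ) :=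
  convexHull ℝ {((0 : ℝ), (0 : ℝ)), ((p.1 : ℝ), (p.1 : ℝ) + p.2),
    ((p.1 : ℝ) - ((p.1 : ℝ) + p.2) / K, (0 : ℝ))}

/-- The transformation `τ(M,N) = (N, (K-1)N - (M+N))`. -/
def tau (K : ℕ) (p : ℤ × ℤ) : ℤ × ℤ :=
  (p.2, ((K : ℤ) - 1) * p.2 - (p.1 + p.2))

/-- The equation `(M+N)^2 = K M N + 1`. -/
def IsSolution (K M N : ℕ) : Prop := (M + N) ^ 2 = K * M * N + 1

variable {k : Type*} [Field k]

/-- Every monomial `x^a y^b` of `f` (with `x = X 0`, `y = X 1`) has `(a,b) ∈ Δ`; equivalently,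
the Newton polygon of `f` lies in the convex set `Δ`. -/
def SupportedIn (Δ : Set (ℝ × ℝ)) (f : MvPolynomial (Fin 2) k) : Prop :=
  ∀ d ∈ f.support, ((d 0 : ℝ), (d 1 : ℝ)) ∈ Δ

/-- `f` vanishes to order (at least) `m` at `e = (1,1)`: the Taylor expansion of `f` at `e`,
i.e. `f(x+1, y+1)`, has no terms of total degree less than `m`. -/
def VanishesToOrder (m : ℕ) (f : MvPolynomial (Fin 2) k) : Prop :=
  ∀ d : Fin 2 →₀ ℕ, d.degree < m → 
    coeff d (aeval (fun i => (X i + 1 : MvPolynomial (Fin 2) k)) f) = 0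

/-- `f` is supported in `Δ`, vanishes to order `m` at `e`, and has constant term `1`. -/
structure IsNormalizedCurve (Δ : Set (ℝ × ℝ)) (m : ℕ) (f : MvPolynomial (Fin 2) k) : Prop where
  supported : SupportedIn Δ f
  vanishes : VanishesToOrder m f
  constantTerm : coeff 0 f = 1

/-- `f` is a normalized polynomial of the curve of `IT(M,N)`, of vanishing order `M + N`. -/
def IsXiInt (K : ℕ) (p : ℤ × ℤ) (f : MvPolynomial (Fin 2) k) : Prop :=
  IsNormalizedCurve (IT K p) (p.1 + p.2).toNat f

/-- `f` is a normalized polynomial of the curve of `RT(M,N)`, of vanishing order `M`. -/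
def IsXiRat (K : ℕ) (p : ℤ × ℤ) (f : MvPolynomial (Fin 2) k) : Prop :=
  IsNormalizedCurve (RT K p) p.1.toNat f

variable (k)

/-- The polynomial `ξ^int_{M,N}`. -/
def xiInt (K : ℕ) (p : ℤ × ℤ) : MvPolynomial (Fin 2) k :=
  Classical.epsilon (IsXiInt K p)

/-- The polynomial `ξ^rat_{M,N}`. -/
def xiRat (K : ℕ) (p : ℤ × ℤ) : MvPolynomial (Fin 2) k :=
  Classical.epsilon (IsXiRat K p)

/-- `ε^int_{M,N}`: the coefficient in `ξ^int_{M,N}` of its highest degree monomial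
`x^(M+N) y^(K N)`, the top vertex of `IT(M,N)`. -/
def epsInt (K M N : ℕ) : k :=
  coeff (Finsupp.single 0 (M + N) + Finsupp.single 1 (K * N)) (xiInt k K (M, N))

/-- `ε^rat_{M,N}`: the coefficient in `ξ^rat_{M,N}` of its highest degree monomial
`x^M y^(M+N)`, the top vertex of `RT(M,N)`. -/
def epsRat (K M N : ℕ) : k :=
  coeff (Finsupp.single 0 M + Finsupp.single 1 (M + N)) (xiRat k K (M, N))

end

/-! Every polynomial in the statement solves one interpolation problem: constant term `1`, support
in the triangle with vertices `(0,0)`, `(m,s)`, `(t/K,0)`, where `s + t = K m`, and vanishing to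
order `m` at `(1,1)`. Both relations are uniqueness statements for this problem.

Uniqueness: if the columns of the triangle other than that of the origin have sizes `1, …, m` in
some order, there are as many unknowns as conditions. Operators `x_i ∂/∂x_i - c` isolate single
coefficients and show the square system to be injective, hence bijective (`eq_zero_of_columns`,
`exists_of_columns`). The sizes are right by a Beatty-type argument: `m/s + m/t = K m²/(st)` exceeds
`1` so slightly that the floors `⌊sx/m⌋` and `⌊tj/m⌋` counting the two sides of the triangle never
collide (`IsBalanced.floor_ne_floor`). The quadratic equation supplies this for `IT`, for `RT`, and
for `K` times `RT`.

Relations: the two factors of each product live in triangles whose slopes are neighbours of the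
target slope `q/p`, one just above and one just below. The product has at most one monomial outside
the target triangle, the top corner of the first factor; a multiple of `x^a (y-1)^b` removes it
(`IsTriangleCurve.mul_sub_corner`), leaving a solution of the target problem. Finally `τ` is a Vieta
jump that decreases `N` when `M > N > 0`, so the relations can be solved recursively by cancelling
nonzero factors. -/

section Vanishing

/-! ### Interpolation at `(1,1)` with prescribed column sizes -/

variable {k : Type*} [Field k]

theorem pderiv_translate (i : Fin 2) (f : MvPolynomial (Fin 2) k) :
    pderiv i (aeval (fun j => (X j + 1 : MvPolynomial (Fin 2) k)) f)
      = aeval (fun j => (X j + 1 : MvPolynomial (Fin 2) k)) (pderiv i f) := by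
  induction f using MvPolynomial.induction_on with
  | C a => simp [algebraMap_eq]
  | add p q hp hq => simp only [map_add, hp, hq]
  | mul_X p j hp =>
    rw [map_mul, Derivation.leibniz, Derivation.leibniz, hp]
    by_cases h : j = i
    · subst h; simp
    · simp [pderiv_X_of_ne h]

/-- The Euler-type operator `x_i ∂/∂x_i - c`. -/
noncomputable def eulerShift (i : Fin 2) (c : ℕ) (f : MvPolynomial (Fin 2) k) :
    MvPolynomial (Fin 2) k :=
  X i * pderiv i f - C (c : k) * f

theorem coeff_eulerShift (i : Fin 2) (c : ℕ) (f : MvPolynomial (Fin 2) k) (d : Fin 2 →₀ ℕ) :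
    coeff d (eulerShift i c f) = ((d i : k) - c) * coeff d f := by
  rw [eulerShift, coeff_sub, coeff_C_mul, coeff_X_mul', sub_mul]
  congr 1
  split_ifs with h
  · rw [coeff_pderiv]
    have h1 : 1 ≤ d i := Nat.one_le_iff_ne_zero.mpr (Finsupp.mem_support_iff.mp h)
    have h2 : d - Finsupp.single i 1 + Finsupp.single i 1 = d :=
      tsub_add_cancel_of_le (Finsupp.single_le_iff.mpr h1)
    rw [h2]
    simp [Nat.cast_sub h1, mul_comm]
  · simp [Finsupp.notMem_support_iff.mp h]

theorem VanishesToOrder.mono {m n : ℕ} {f : MvPolynomial (Fin 2) k} (h : VanishesToOrder n f)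
    (hmn : m ≤ n) : VanishesToOrder m f :=
  fun d hd => h d (hd.trans_le hmn)

theorem VanishesToOrder.sub {m : ℕ} {f g : MvPolynomial (Fin 2) k} (hf : VanishesToOrder m f)
    (hg : VanishesToOrder m g) : VanishesToOrder m (f - g) := by
  intro d hd
  rw [map_sub, coeff_sub, hf d hd, hg d hd, sub_zero]

theorem VanishesToOrder.mul {m n : ℕ} {f g : MvPolynomial (Fin 2) k} (hf : VanishesToOrder m f)
    (hg : VanishesToOrder n g) : VanishesToOrder (m + n) (f * g) := by
  intro d hd
  rw [map_mul, coeff_mul]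
  refine Finset.sum_eq_zero fun x hx => ?_
  have hx' : x.1.degree + x.2.degree = d.degree := by
    rw [← map_add, Finset.HasAntidiagonal.mem_antidiagonal.mp hx]
  rcases lt_or_ge x.1.degree m with h | h
  · rw [hf _ h, zero_mul]
  · rw [hg _ (by omega), mul_zero]

theorem vanishesToOrder_zero (f : MvPolynomial (Fin 2) k) : VanishesToOrder 0 f :=
  fun _ hd => absurd hd (Nat.not_lt_zero _)

theorem VanishesToOrder.pow {m : ℕ} {f : MvPolynomial (Fin 2) k} (hf : VanishesToOrder m f)
    (n : ℕ) : VanishesToOrder (n * m) (f ^ n) := by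
  induction n with
  | zero => rw [zero_mul]; exact vanishesToOrder_zero _
  | succ n ih => rw [pow_succ, Nat.succ_mul]; exact ih.mul hf

theorem vanishesToOrder_one_iff {f : MvPolynomial (Fin 2) k} :
    VanishesToOrder 1 f ↔ ∑ d ∈ f.support, coeff d f = 0 := by
  have key : coeff 0 (aeval (fun i => (X i + 1 : MvPolynomial (Fin 2) k)) f)
      = ∑ d ∈ f.support, coeff d f := by
    rw [← constantCoeff_eq, aeval_def, eval₂_eq, map_sum]
    refine Finset.sum_congr rfl fun d _ => ?_
    simp [algebraMap_eq]
  constructor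
  · intro h
    rw [← key]
    exact h 0 (by simp)
  · intro h d hd
    have : d = 0 := (Finsupp.degree_eq_zero_iff d).mp (Nat.lt_one_iff.mp hd)
    rw [this, key, h]

theorem VanishesToOrder.eulerShift {m : ℕ} {f : MvPolynomial (Fin 2) k}
    (hf : VanishesToOrder (m + 1) f) (i : Fin 2) (c : ℕ) :
    VanishesToOrder m (eulerShift i c f) := by
  have hd : VanishesToOrder m (pderiv i f) := by
    intro d hd
    rw [← pderiv_translate, coeff_pderiv, hf, zero_mul]
    rw [map_add, Finsupp.degree_single]
    omega
  have h1 := (vanishesToOrder_zero (X i : MvPolynomial (Fin 2) k)).mul hd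
  have h2 := (vanishesToOrder_zero (C (c : k) : MvPolynomial (Fin 2) k)).mul
    (hf.mono (Nat.le_succ m))
  rw [zero_add] at h1 h2
  exact h1.sub h2

/-- Each operator `x_i ∂/∂x_i - c` costs one order of vanishing and erases all monomials whose
`i`-th exponent is `c`. -/
theorem VanishesToOrder.exists_euler_prod {f : MvPolynomial (Fin 2) k} (i : Fin 2)
    (A : Finset ℕ) : ∀ {m : ℕ}, VanishesToOrder (m + A.card) f →
    ∃ g : MvPolynomial (Fin 2) k, VanishesToOrder m g ∧
      ∀ d, coeff d g = (∏ c ∈ A, ((d i : k) - c)) * coeff d f := by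
  induction A using Finset.induction_on with
  | empty => intro m h; exact ⟨f, by simpa using h, by simp⟩
  | insert c A hc ih =>
    intro m h
    rw [Finset.card_insert_of_notMem hc] at h
    obtain ⟨g, hg, hg'⟩ := ih (m := m + 1) (h.mono (by omega))
    refine ⟨_, hg.eulerShift i c, fun d => ?_⟩
    rw [coeff_eulerShift, hg', Finset.prod_insert hc, mul_assoc]

/-- If `f` vanishes to high order at `(1,1)` compared to the number of columns meeting its
support and the number of points in the column of `d`, then the coefficient at `d` is zero. -/
theorem VanishesToOrder.coeff_eq_zero [CharZero k] {m : ℕ} {f : MvPolynomial (Fin 2) k}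
    (hf : VanishesToOrder m f) {A B : Finset ℕ} {d : Fin 2 →₀ ℕ} (hdA : d 0 ∈ A) (hdB : d 1 ∈ B)
    (hA : ∀ e ∈ f.support, e 0 ∈ A) (hB : ∀ e ∈ f.support, e 0 = d 0 → e 1 ∈ B)
    (hcard : A.card + B.card ≤ m + 1) : coeff d f = 0 := by
  have hA1 := Finset.card_erase_add_one hdA
  have hB1 := Finset.card_erase_add_one hdB
  -- Erase every other column, then every other point of the column of `d`. One order of vanishing
  -- is left, so the coefficients of the result sum to zero, while only the one at `d` can survive.
  obtain ⟨g, hg, hgc⟩ := VanishesToOrder.exists_euler_prod (f := f) 0 (A.erase (d 0))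
    (m := 1 + (B.erase (d 1)).card) (hf.mono (by omega))
  obtain ⟨h, hh, hhc⟩ := hg.exists_euler_prod 1 (B.erase (d 1))
  rw [vanishesToOrder_one_iff] at hh
  have hzero : ∀ e, e ≠ d → coeff e h = 0 := by
    intro e he
    rw [hhc, hgc]
    by_cases hes : e ∈ f.support
    · by_cases h0 : e 0 = d 0
      · have h1 : e 1 ≠ d 1 := by
          intro h1
          apply he
          ext j
          fin_cases j
          · exact h0
          · exact h1
        rw [Finset.prod_eq_zero (Finset.mem_erase.mpr ⟨h1, hB e hes h0⟩) (sub_self _), zero_mul]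
      · rw [Finset.prod_eq_zero (s := A.erase (d 0))
          (Finset.mem_erase.mpr ⟨h0, hA e hes⟩) (sub_self _), zero_mul, mul_zero]
    · rw [notMem_support_iff.mp hes, mul_zero, mul_zero]
  have hd : coeff d h = 0 := by
    by_contra hne
    apply hne
    rw [← hh, Finset.sum_eq_single_of_mem d (mem_support_iff.mpr hne)]
    exact fun e _ he => hzero e he
  rw [hhc, hgc] at hd
  have hP : ∀ (i : Fin 2) (S : Finset ℕ), (∏ c ∈ S.erase (d i), ((d i : k) - c)) ≠ 0 := by
    intro i S
    refine Finset.prod_ne_zero_iff.mpr fun c hc => sub_ne_zero.mpr ?_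
    exact_mod_cast (Finset.ne_of_mem_erase hc).symm
  exact (mul_eq_zero.mp ((mul_eq_zero.mp hd).resolve_left (hP 1 B))).resolve_left (hP 0 A)

/-- A polynomial whose support has columns `1, …, m` of pairwise different sizes at most `m` and
which vanishes to order `m` at `(1,1)` is zero. -/
theorem eq_zero_of_columns [CharZero k] {m : ℕ} {B : ℕ → Finset ℕ}
    (hmaps : ∀ a ∈ Finset.Icc 1 m, (B a).card ≤ m)
    (hinj : Set.InjOn (fun a => (B a).card) (Finset.Icc 1 m)) {f : MvPolynomial (Fin 2) k}
    (hf : VanishesToOrder m f)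
    (hsupp : ∀ d ∈ f.support, d 0 ∈ Finset.Icc 1 m ∧ d 1 ∈ B (d 0)) : f = 0 := by
  -- Columns are eliminated by increasing size. Once those of size at most `v` are empty, at most `m
  -- - v` columns remain, and `(m - v) + (v + 1) = m + 1` is just enough to empty the column of size
  -- `v + 1`.
  have key : ∀ v, ∀ d ∈ f.support, v < (B (d 0)).card := by
    intro v
    induction v with
    | zero => exact fun d hd => Finset.card_pos.mpr ⟨_, (hsupp d hd).2⟩
    | succ v ih =>
      intro d hd
      by_contra hlt
      have hv : (B (d 0)).card = v + 1 := by have := ih d hd; omega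
      have hle : v + 1 ≤ m := hv ▸ hmaps _ (hsupp d hd).1
      refine mem_support_iff.mp hd (hf.coeff_eq_zero
        (A := (Finset.Icc 1 m).filter fun a => v < (B a).card) (B := B (d 0))
        (Finset.mem_filter.mpr ⟨(hsupp d hd).1, ih d hd⟩) (hsupp d hd).2
        (fun e he => Finset.mem_filter.mpr ⟨(hsupp e he).1, ih e he⟩)
        (fun e he h => h ▸ (hsupp e he).2) ?_)
      have : ((Finset.Icc 1 m).filter fun a => v < (B a).card).card
          ≤ (Finset.Icc (v + 1) m).card := by
        refine Finset.card_le_card_of_injOn (fun a => (B a).card) ?_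
          (hinj.mono (Finset.coe_subset.mpr (Finset.filter_subset _ _)))
        intro a ha
        have ha := Finset.mem_filter.mp ha
        exact Finset.mem_coe.mpr (Finset.mem_Icc.mpr ⟨ha.2, hmaps a ha.1⟩)
      rw [Nat.card_Icc] at this
      omega
  by_contra hne
  obtain ⟨d, hd⟩ := support_nonempty.mpr hne
  exact absurd (key m d hd) (not_lt.mpr (hmaps _ (hsupp d hd).1))

theorem eq_single_add_single (d : Fin 2 →₀ ℕ) :
    d = Finsupp.single 0 (d 0) + Finsupp.single 1 (d 1) := by
  ext j
  fin_cases j <;> simp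

/-- The interpolation problem with columns of sizes `1, …, m` (in some order) and order `m` of
vanishing has a solution with constant term `1`. -/
theorem exists_of_columns [CharZero k] {m : ℕ} {B : ℕ → Finset ℕ}
    (hmaps : ∀ a ∈ Finset.Icc 1 m, (B a).card ∈ Finset.Icc 1 m)
    (hinj : Set.InjOn (fun a => (B a).card) (Finset.Icc 1 m)) :
    ∃ f : MvPolynomial (Fin 2) k, VanishesToOrder m f ∧ coeff 0 f = 1 ∧
      ∀ d ∈ f.support, d = 0 ∨ d 0 ∈ Finset.Icc 1 m ∧ d 1 ∈ B (d 0) := by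
  classical
  set S : Finset (Σ _ : ℕ, ℕ) := (Finset.Icc 1 m).sigma B with hS
  -- `S` indexes the unknown coefficients and `D` the Taylor coefficients of degree below `m`; both
  -- have `1 + ⋯ + m` elements.
  set D : Finset (Σ _ : ℕ, ℕ) := (Finset.range m).sigma fun i => Finset.range (m - i) with hD
  have himage : (Finset.Icc 1 m).image (fun a => (B a).card) = Finset.Icc 1 m :=
    Finset.eq_of_subset_of_card_le (Finset.image_subset_iff.mpr hmaps)
      (Finset.card_image_of_injOn hinj).ge
  have hcard : S.card = D.card := by
    rw [hS, hD, Finset.card_sigma, Finset.card_sigma]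
    simp only [Finset.card_range]
    have h1 : ∑ a ∈ Finset.Icc 1 m, (B a).card = ∑ v ∈ Finset.Icc 1 m, v := by
      conv_rhs => rw [← himage, Finset.sum_image hinj]
    rw [h1]
    refine Finset.sum_bij' (fun v _ => m - v) (fun i _ => m - i) ?_ ?_ ?_ ?_ ?_ <;>
      simp only [Finset.mem_Icc, Finset.mem_range] <;> intros <;> omega
  let e : (Σ _ : ℕ, ℕ) → (Fin 2 →₀ ℕ) := fun p => Finsupp.single 0 p.1 + Finsupp.single 1 p.2
  have he0 : ∀ p, e p 0 = p.1 := fun p => by simp [e]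
  have he1 : ∀ p, e p 1 = p.2 := fun p => by simp [e]
  have hinje : Function.Injective e := by
    intro p q h
    have h0 := he0 p
    have h1 := he1 p
    rw [h, he0] at h0
    rw [h, he1] at h1
    exact Sigma.ext h0.symm (heq_of_eq h1.symm)
  let P : (S → k) →ₗ[k] MvPolynomial (Fin 2) k := ∑ p : S, (monomial (e p)) ∘ₗ LinearMap.proj p
  have hP : ∀ u d, coeff d (P u) = ∑ p : S, if e p = d then u p else 0 := by
    intro u d
    simp [P, LinearMap.sum_apply, coeff_sum, coeff_monomial]
  have hPsupp : ∀ u, ∀ d ∈ (P u).support, d 0 ∈ Finset.Icc 1 m ∧ d 1 ∈ B (d 0) := by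
    intro u d hd
    rw [mem_support_iff, hP] at hd
    obtain ⟨p, -, hp⟩ := Finset.exists_ne_zero_of_sum_ne_zero hd
    have hpd : e p = d := by
      by_contra h
      exact hp (if_neg h)
    rw [← hpd, he0, he1]
    exact Finset.mem_sigma.mp p.2
  let L : (S → k) →ₗ[k] (D → k) := LinearMap.pi fun q =>
    lcoeff k (e q) ∘ₗ (aeval (fun i => (X i + 1 : MvPolynomial (Fin 2) k))).toLinearMap ∘ₗ P
  have hL : ∀ u q, L u q
      = coeff (e q) (aeval (fun i => (X i + 1 : MvPolynomial (Fin 2) k)) (P u)) :=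
    fun _ _ => rfl
  have hDmem : ∀ d : Fin 2 →₀ ℕ, d.degree < m → ∃ q : D, e q = d := by
    intro d hd
    have hdeg : d.degree = d 0 + d 1 := by
      conv_lhs => rw [eq_single_add_single d]
      rw [map_add, Finsupp.degree_single, Finsupp.degree_single]
    refine ⟨⟨⟨d 0, d 1⟩, ?_⟩, (eq_single_add_single d).symm⟩
    rw [hD, Finset.mem_sigma, Finset.mem_range, Finset.mem_range]
    dsimp only
    omega
  have hLinj : Function.Injective L := by
    rw [← LinearMap.ker_eq_bot, LinearMap.ker_eq_bot']
    intro u hu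
    have hv : VanishesToOrder m (P u) := by
      intro d hd
      obtain ⟨q, rfl⟩ := hDmem d hd
      rw [← hL, hu, Pi.zero_apply]
    have h0 := eq_zero_of_columns (fun a ha => (Finset.mem_Icc.mp (hmaps a ha)).2) hinj hv
      (hPsupp u)
    funext p
    have hp := hP u (e p)
    rw [h0, coeff_zero, Finset.sum_eq_single p, if_pos rfl] at hp
    · exact hp.symm
    · intro q _ hq
      rw [if_neg]
      exact fun h => hq (Subtype.ext (hinje h))
    · simp
  have hLsurj : Function.Surjective L := by
    refine (LinearMap.injective_iff_surjective_of_finrank_eq_finrank ?_).mp hLinj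
    rw [Module.finrank_fintype_fun_eq_card, Module.finrank_fintype_fun_eq_card,
      Fintype.card_coe, Fintype.card_coe, hcard]
  -- The correction `P u` is chosen to cancel the Taylor coefficients of the constant `1` in degrees
  -- below `m`.
  obtain ⟨u, hu⟩ := hLsurj fun q =>
    -coeff (e q) (aeval (fun i => (X i + 1 : MvPolynomial (Fin 2) k))
      (1 : MvPolynomial (Fin 2) k))
  refine ⟨1 + P u, ?_, ?_, ?_⟩
  · intro d hd
    obtain ⟨q, rfl⟩ := hDmem d hd
    rw [map_add, coeff_add, ← hL, hu, add_neg_cancel]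
  · have : coeff 0 (P u) = 0 := by
      by_contra h
      have := (hPsupp u 0 (mem_support_iff.mpr h)).1
      simp at this
    rw [coeff_add, this, add_zero, coeff_zero_one]
  · intro d hd
    by_cases h0 : d = 0
    · exact Or.inl h0
    · refine Or.inr (hPsupp u d ?_)
      rw [mem_support_iff, coeff_add, coeff_one, if_neg (Ne.symm h0), zero_add] at hd
      exact mem_support_iff.mpr hd

end Vanishing

/-! ### Lattice points of balanced triangles -/

/-- The lattice points `(a, b)` of the triangle with vertices `(0,0)`, `(m, s)`, `(t / K, 0)`, where
`s + t = K * m`. -/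
def InTriangle (K m s t a b : ℕ) : Prop := a ≤ m ∧ m * b ≤ s * a ∧ K * a ≤ t + b

/-- Numerical conditions under which the columns of the triangle with vertices `(0,0)`, `(m, s)`,
`(t / K, 0)`, other than the column of the origin, have sizes `1, …, m` in some order. -/
structure IsBalanced (K m s t : ℕ) : Prop where
  pos : 0 < m
  add_eq : s + t = K * m
  large : m = 1 ∨ m ≤ s ∧ m ≤ t
  exists_defect : ∃ c δ, c ∣ m ∧ c ∣ s ∧ c ∣ t ∧ 0 < δ ∧ δ ≤ K * c ∧ s * t + δ = K * m ^ 2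

/-- The column of the triangle over `a`. -/
def triangleColumn (K m s t a : ℕ) : Finset ℕ := Finset.Icc (K * a - t) (s * a / m)

namespace IsBalanced

variable {K m s t : ℕ}

theorem inTriangle_iff (h : IsBalanced K m s t) {a b : ℕ} :
    InTriangle K m s t a b ↔
      (a = 0 ∧ b = 0) ∨ a ∈ Finset.Icc 1 m ∧ b ∈ triangleColumn K m s t a := by
  have hm := h.pos
  simp only [InTriangle, triangleColumn, Finset.mem_Icc, Nat.le_div_iff_mul_le hm]
  rw [mul_comm b m]
  constructor
  · rintro ⟨h1, h2, h3⟩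
    rcases Nat.eq_zero_or_pos a with rfl | ha
    · left
      rw [mul_zero] at h2
      exact ⟨rfl, by simpa [hm.ne'] using h2⟩
    · right
      exact ⟨⟨ha, h1⟩, by omega, h2⟩
  · rintro (⟨rfl, rfl⟩ | ⟨⟨h0, h1⟩, h2, h3⟩)
    · simp
    · exact ⟨h1, h3, by omega⟩

theorem card_column_of_le {a : ℕ} (h : K * a ≤ t) :
    (triangleColumn K m s t a).card = s * a / m + 1 := by
  rw [triangleColumn, Nat.card_Icc, Nat.sub_eq_zero_of_le h, Nat.sub_zero]

/-- If `r = K a - t` is the bottom of the column, then `s a = t (m - a) + m r`, so `r` cancels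
between top and bottom and the size depends only on the distance `m - a` to the right edge. -/
theorem card_column_of_lt (h : IsBalanced K m s t) {a : ℕ} (ham : a ≤ m) (hlt : t < K * a) :
    (triangleColumn K m s t a).card = t * (m - a) / m + 1 := by
  obtain ⟨j, rfl⟩ := Nat.exists_eq_add_of_le ham
  obtain ⟨r, hr⟩ := Nat.exists_eq_add_of_le hlt.le
  have hadd := h.add_eq
  have : s * a = t * j + (a + j) * r := by
    have hs : s = r + K * j := by nlinarith
    subst hs
    have : K * j * a = (t + r) * j := by rw [← hr]; ring
    nlinarith
  rw [triangleColumn, Nat.card_Icc, this, Nat.add_mul_div_left _ _ h.pos, hr]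
  simp only [Nat.add_sub_cancel_left]
  rw [add_right_comm, Nat.add_sub_cancel]

theorem card_column_mem (h : IsBalanced K m s t) {a : ℕ} (ha : a ∈ Finset.Icc 1 m) :
    (triangleColumn K m s t a).card ∈ Finset.Icc 1 m := by
  obtain ⟨c, δ, -, -, -, hδ, -, hst⟩ := h.exists_defect
  have hm := h.pos
  have hadd := h.add_eq
  rw [Finset.mem_Icc] at ha ⊢
  have hK : 0 < K := by
    rcases Nat.eq_zero_or_pos K with rfl | hK
    · rw [zero_mul] at hst; omega
    · exact hK
  rcases le_or_gt (K * a) t with hle | hlt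
  · rw [card_column_of_le hle]
    refine ⟨Nat.le_add_left _ _, ?_⟩
    rw [Nat.succ_le_iff, Nat.div_lt_iff_lt_mul hm]
    have h1 : s * (K * a) ≤ s * t := Nat.mul_le_mul_left _ hle
    have h2 : K * (s * a) < K * (m * m) := by nlinarith
    exact lt_of_mul_lt_mul_left h2 (Nat.zero_le _)
  · rw [h.card_column_of_lt ha.2 hlt]
    refine ⟨Nat.le_add_left _ _, ?_⟩
    rw [Nat.succ_le_iff, Nat.div_lt_iff_lt_mul hm]
    obtain ⟨j, hj⟩ := Nat.exists_eq_add_of_le ha.2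
    have hj' : m - a = j := by omega
    rw [hj']
    have h0 : K * j ≤ s := by
      have : K * m = K * a + K * j := by rw [hj]; ring
      omega
    have h1 : t * (K * j) ≤ t * s := Nat.mul_le_mul_left _ h0
    have h2 : K * (t * j) < K * (m * m) := by nlinarith
    exact lt_of_mul_lt_mul_left h2 (Nat.zero_le _)

theorem mul_div_strictMono {m s : ℕ} (hm : 0 < m) (hms : m ≤ s) :
    StrictMono fun a => s * a / m := by
  refine strictMono_nat_of_lt_succ fun a => ?_
  have h1 : s * a / m + 1 = (s * a + m) / m := (Nat.add_div_right _ hm).symm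
  have h2 : (s * a + m) / m ≤ s * (a + 1) / m := Nat.div_le_div_right (by nlinarith)
  exact Nat.lt_of_succ_le (by omega)

/-- If both floors equal `v`, adding the two lower bounds gives `v < x + j`, since `s t < K m²`, and
adding the two upper bounds gives `x + j < v + 1`. Dividing out `c` first sharpens the integer gap
in the upper bounds; this is why a defect `δ` as large as `K c` is allowed. -/
theorem floor_ne_floor (h : IsBalanced K m s t) {x j : ℕ} (hpos : 0 < x) (hxj : x + j < m) :
    s * x / m ≠ t * j / m := by
  obtain ⟨c, δ, ⟨m', rfl⟩, ⟨s', rfl⟩, ⟨t', rfl⟩, hδ, hδK, hst⟩ := h.exists_defect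
  have hm := h.pos
  have hadd := h.add_eq
  have hc : 0 < c := Nat.pos_of_mul_pos_right hm
  have hm' : 0 < m' := Nat.pos_of_mul_pos_left hm
  intro heq
  rw [mul_assoc, mul_assoc, Nat.mul_div_mul_left _ _ hc, Nat.mul_div_mul_left _ _ hc] at heq
  set v := s' * x / m' with hv
  have hadd' : s' + t' = K * m' := by
    have : c * (s' + t') = c * (K * m') := by rw [mul_add, hadd]; ring
    exact Nat.eq_of_mul_eq_mul_left hc this
  have l1 : m' * v ≤ s' * x := Nat.mul_div_le _ _
  have l2 : m' * v ≤ t' * j := heq ▸ Nat.mul_div_le _ _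
  have u1 : s' * x + 1 ≤ m' * (v + 1) := Nat.lt_mul_div_succ _ hm'
  have u2 : t' * j + 1 ≤ m' * (v + 1) := by rw [heq]; exact Nat.lt_mul_div_succ _ hm'
  have hcδ : c ^ 2 * (s' * t') + δ = c ^ 2 * (K * m' ^ 2) := by nlinarith
  have e1 : (s' + t') * (m' * v) ≤ s' * t' * (x + j) := by nlinarith
  have e2 : s' * t' * (x + j) + (s' + t') ≤ (s' + t') * (m' * (v + 1)) := by nlinarith
  rw [hadd'] at e1 e2
  have hK : 0 < K * c := by omega
  have hK' : 0 < K := Nat.pos_of_mul_pos_right hK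
  have hlt : s' * t' < K * m' ^ 2 :=
    lt_of_mul_lt_mul_left (by omega : c ^ 2 * (s' * t') < c ^ 2 * (K * m' ^ 2)) (Nat.zero_le _)
  have hv1 : v < x + j := by
    have : K * m' ^ 2 * v < K * m' ^ 2 * (x + j) :=
      calc K * m' ^ 2 * v = K * m' * (m' * v) := by ring
        _ ≤ s' * t' * (x + j) := e1
        _ < K * m' ^ 2 * (x + j) := Nat.mul_lt_mul_of_pos_right hlt (by omega)
    exact lt_of_mul_lt_mul_left this (Nat.zero_le _)
  have hv2 : x + j < v + 1 := by
    have h1 : δ * (x + j) < K * c * (c * m') :=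
      lt_of_le_of_lt (Nat.mul_le_mul_right _ hδK) (Nat.mul_lt_mul_of_pos_left hxj hK)
    have h2 : c ^ 2 * (K * m' ^ 2) * (x + j) < c ^ 2 * (K * m' ^ 2) * (v + 1) := by
      have := Nat.mul_le_mul_left (c ^ 2) e2
      rw [← hcδ, add_mul, hcδ]
      nlinarith
    exact lt_of_mul_lt_mul_left h2 (Nat.zero_le _)
  omega

/-- Sizes are strictly monotone on each side of `t / K` because the slopes `s/m` and `t/m` are at
least `1`; across the two sides, `floor_ne_floor` separates them. -/
theorem card_column_injOn (h : IsBalanced K m s t) :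
    Set.InjOn (fun a => (triangleColumn K m s t a).card) (Finset.Icc 1 m) := by
  have hm := h.pos
  intro a ha b hb hab
  rw [Finset.mem_coe, Finset.mem_Icc] at ha hb
  rcases h.large with h1 | ⟨hs, ht⟩
  · omega
  dsimp only at hab
  have cross : ∀ {a b : ℕ}, 1 ≤ a → b ≤ m → K * a ≤ t → t < K * b →
      (triangleColumn K m s t a).card ≠ (triangleColumn K m s t b).card := by
    intro a b ha hb hat hbt
    rw [card_column_of_le hat, h.card_column_of_lt hb hbt]
    have hab : a < b := lt_of_mul_lt_mul_left (hat.trans_lt hbt) (Nat.zero_le _)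
    have := h.floor_ne_floor (x := a) (j := m - b) ha (by omega)
    omega
  rcases le_or_gt (K * a) t with hat | hat <;> rcases le_or_gt (K * b) t with hbt | hbt
  · rw [card_column_of_le hat, card_column_of_le hbt] at hab
    exact (mul_div_strictMono hm hs).injective (Nat.succ_injective hab)
  · exact absurd hab (cross ha.1 hb.2 hat hbt)
  · exact absurd hab.symm (cross hb.1 ha.2 hbt hat)
  · rw [h.card_column_of_lt ha.2 hat, h.card_column_of_lt hb.2 hbt] at hab
    have := (mul_div_strictMono hm ht).injective (Nat.succ_injective hab)
    omega

variable {k : Type*} [Field k] [CharZero k]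

theorem exists_curve (h : IsBalanced K m s t) :
    ∃ f : MvPolynomial (Fin 2) k, VanishesToOrder m f ∧ coeff 0 f = 1 ∧
      ∀ d ∈ f.support, InTriangle K m s t (d 0) (d 1) := by
  obtain ⟨f, hf, hf0, hsupp⟩ := exists_of_columns (k := k) (fun _ ha => h.card_column_mem ha)
    h.card_column_injOn
  refine ⟨f, hf, hf0, fun d hd => h.inTriangle_iff.mpr ?_⟩
  rcases hsupp d hd with rfl | hd'
  · simp
  · exact Or.inr hd'

theorem curve_unique (h : IsBalanced K m s t) {f g : MvPolynomial (Fin 2) k}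
    (hf : VanishesToOrder m f) (hg : VanishesToOrder m g) (hfg : coeff 0 f = coeff 0 g)
    (hfs : ∀ d ∈ f.support, InTriangle K m s t (d 0) (d 1))
    (hgs : ∀ d ∈ g.support, InTriangle K m s t (d 0) (d 1)) : f = g := by
  classical
  rw [← sub_eq_zero]
  refine eq_zero_of_columns (fun a ha => (Finset.mem_Icc.mp (h.card_column_mem ha)).2)
    h.card_column_injOn (hf.sub hg) fun d hd => ?_
  have hd0 : d ≠ 0 := by
    rintro rfl
    rw [mem_support_iff, coeff_sub, hfg, sub_self] at hd
    exact hd rfl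
  have hT : InTriangle K m s t (d 0) (d 1) := by
    rcases Finset.mem_union.mp (support_sub _ f g hd) with h' | h'
    · exact hfs d h'
    · exact hgs d h'
  refine (h.inTriangle_iff.mp hT).resolve_left fun h' => hd0 ?_
  rw [eq_single_add_single d, h'.1, h'.2]
  simp

end IsBalanced

theorem mem_convexHull_triangle_iff {K m s t a b : ℕ} (hK : 0 < K) (hm : 0 < m)
    (h : s + t = K * m) :
    ((a : ℝ), (b : ℝ)) ∈ convexHull ℝ
      {((0 : ℝ), (0 : ℝ)), ((m : ℝ), (s : ℝ)), ((t : ℝ) / K, (0 : ℝ))} ↔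
      InTriangle K m s t a b := by
  have hK' : (0 : ℝ) < K := by exact_mod_cast hK
  have hm' : (0 : ℝ) < m := by exact_mod_cast hm
  have h' : (s : ℝ) + t = K * m := by exact_mod_cast h
  have hs0 : (0 : ℝ) ≤ s := Nat.cast_nonneg _
  have ht0 : (0 : ℝ) ≤ t := Nat.cast_nonneg _
  constructor
  · intro hab
    have hconv : Convex ℝ {p : ℝ × ℝ | p.1 ≤ m ∧ m * p.2 ≤ s * p.1 ∧ K * p.1 ≤ t + p.2} := by
      rintro x ⟨hx1, hx2, hx3⟩ y ⟨hy1, hy2, hy3⟩ u v hu hv huv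
      simp only [Set.mem_ofPred_eq, Prod.fst_add, Prod.snd_add, Prod.smul_fst, Prod.smul_snd,
        smul_eq_mul]
      have hv' : v = 1 - u := by linarith
      refine ⟨?_, ?_, ?_⟩
      · have := mul_le_mul_of_nonneg_left hx1 hu
        have := mul_le_mul_of_nonneg_left hy1 hv
        subst hv'
        linarith
      · have := mul_le_mul_of_nonneg_left hx2 hu
        have := mul_le_mul_of_nonneg_left hy2 hv
        linarith
      · have := mul_le_mul_of_nonneg_left hx3 hu
        have := mul_le_mul_of_nonneg_left hy3 hv
        subst hv'
        linarith
    have hmem := convexHull_min (t := {p : ℝ × ℝ | p.1 ≤ m ∧ m * p.2 ≤ s * p.1 ∧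
      K * p.1 ≤ t + p.2}) ?_ hconv hab
    · obtain ⟨h1, h2, h3⟩ := hmem
      dsimp only at h1 h2 h3
      exact ⟨by exact_mod_cast h1, by exact_mod_cast h2, by exact_mod_cast h3⟩
    · rintro p (rfl | rfl | rfl)
      · simp
      · exact ⟨le_rfl, le_of_eq (mul_comm _ _), by simp only; linarith⟩
      · refine ⟨?_, ?_, ?_⟩
        · rw [div_le_iff₀ hK']
          linarith
        · simp only [mul_zero]
          positivity
        · simp only [mul_div_cancel₀ _ hK'.ne']
          linarith
  · rintro ⟨h1, h2, h3⟩
    have h1' : (a : ℝ) ≤ m := by exact_mod_cast h1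
    have h2' : (m : ℝ) * b ≤ s * a := by exact_mod_cast h2
    have h3' : (K : ℝ) * a ≤ t + b := by exact_mod_cast h3
    have ha0 : (0 : ℝ) ≤ a := Nat.cast_nonneg _
    have hb0 : (0 : ℝ) ≤ b := Nat.cast_nonneg _
    -- `u` and `v` are the barycentric weights of `(m, s)` and `(t/K, 0)`. The triangle is
    -- degenerate when `s = 0` or `t = 0`, and these cases need separate weights.
    suffices hw : ∃ u v : ℝ, 0 ≤ u ∧ 0 ≤ v ∧ u + v ≤ 1 ∧ u * m + v * (t / K) = a ∧ u * s = b by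
      obtain ⟨u, v, hu, hv, huv, e1, e2⟩ := hw
      have := (convex_convexHull ℝ
        {((0 : ℝ), (0 : ℝ)), ((m : ℝ), (s : ℝ)), ((t : ℝ) / K, (0 : ℝ))}).sum_mem
        (t := Finset.univ) (w := ![1 - u - v, u, v])
        (z := ![((0 : ℝ), (0 : ℝ)), ((m : ℝ), (s : ℝ)), ((t : ℝ) / K, (0 : ℝ))])
        (by
          intro i _
          fin_cases i
          · simp; linarith
          · simpa
          · simpa)
        (by simp [Fin.sum_univ_three]; ring)
        (by
          intro i _
          apply subset_convexHull
          fin_cases i <;> simp)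
      simpa [Fin.sum_univ_three, e1, e2] using this
    rcases hs0.eq_or_lt with hs | hs
    · have hb : (b : ℝ) = 0 := by
        rw [← hs, zero_mul] at h2'
        exact le_antisymm (nonpos_of_mul_nonpos_right h2' hm') hb0
      have ht : (t : ℝ) = K * m := by linarith
      refine ⟨0, a / m, le_rfl, by positivity, ?_, ?_, by simp [hb]⟩
      · rw [zero_add]
        exact div_le_one_of_le₀ h1' hm'.le
      · rw [ht]
        field_simp
        ring
    · rcases ht0.eq_or_lt with ht | ht
      · have hs' : (s : ℝ) = K * m := by linarith
        have hb : (b : ℝ) = K * a := by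
          apply le_antisymm
          · rw [hs'] at h2'
            refine le_of_mul_le_mul_left ?_ hm'
            linarith
          · linarith
        refine ⟨a / m, 0, by positivity, le_rfl, ?_, ?_, ?_⟩
        · rw [add_zero]
          exact div_le_one_of_le₀ h1' hm'.le
        · field_simp
          ring
        · rw [hs', hb]
          field_simp
      · refine ⟨b / s, K * (s * a - m * b) / (s * t), by positivity, ?_, ?_, ?_, ?_⟩
        · have : (0 : ℝ) ≤ s * a - m * b := by linarith
          positivity
        · have : (b : ℝ) / s + K * (s * a - m * b) / (s * t)
              = (b * t + K * (s * a - m * b)) / (s * t) := by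
            field_simp
          rw [this]
          refine div_le_one_of_le₀ ?_ (by positivity)
          have e : (K : ℝ) * (m * b) = (s + t) * b := by rw [h']; ring
          have := mul_le_mul_of_nonneg_left h3' hs0
          nlinarith
        · field_simp
          ring
        · field_simp

/-! ### Triangle curves, their products and powers -/

section Curves

variable {k : Type*} [Field k]

/-- `f` has constant term `1`, is supported in the triangle with vertices `(0,0)`, `(m, s)`,
`(t / K, 0)`, and vanishes to order `m` at `(1,1)`. -/
structure IsTriangleCurve (K m s t : ℕ) (f : MvPolynomial (Fin 2) k) : Prop where
  vanishes : VanishesToOrder m f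
  constantTerm : coeff 0 f = 1
  supported : ∀ d ∈ f.support, InTriangle K m s t (d 0) (d 1)

theorem IsBalanced.existsUnique_curve [CharZero k] {K m s t : ℕ} (h : IsBalanced K m s t) :
    ∃! f : MvPolynomial (Fin 2) k, IsTriangleCurve K m s t f := by
  obtain ⟨f, hf, hf0, hfs⟩ := h.exists_curve (k := k)
  exact ⟨f, ⟨hf, hf0, hfs⟩, fun g hg =>
    h.curve_unique hg.vanishes hf (hg.constantTerm.trans hf0.symm) hg.supported hfs⟩

theorem isXiInt_iff {K M N : ℕ} (hK : 0 < K) (h : 0 < M + N) {f : MvPolynomial (Fin 2) k} :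
    IsXiInt K (M, N) f ↔ IsTriangleCurve K (M + N) (K * N) (K * M) f := by
  have hIT : ∀ a b : ℕ, ((a : ℝ), (b : ℝ)) ∈ IT K (M, N) ↔
      InTriangle K (M + N) (K * N) (K * M) a b := by
    intro a b
    rw [← mem_convexHull_triangle_iff hK h (by ring), IT]
    have : (K : ℝ) ≠ 0 := by exact_mod_cast hK.ne'
    simp [mul_div_cancel_left₀ _ this]
  have hord : ((M : ℤ) + (N : ℤ)).toNat = M + N := by omega
  constructor
  · rintro ⟨h1, h2, h3⟩
    exact ⟨hord ▸ h2, h3, fun d hd => (hIT _ _).mp (h1 d hd)⟩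
  · rintro ⟨h1, h2, h3⟩
    exact ⟨fun d hd => (hIT _ _).mpr (h3 d hd), hord.symm ▸ h1, h2⟩

theorem isXiRat_iff {K M N t : ℕ} (hK : 0 < K) (hM : 0 < M) (ht : M + N + t = K * M)
    {f : MvPolynomial (Fin 2) k} :
    IsXiRat K (M, N) f ↔ IsTriangleCurve K M (M + N) t f := by
  have hRT : ∀ a b : ℕ, ((a : ℝ), (b : ℝ)) ∈ RT K (M, N) ↔ InTriangle K M (M + N) t a b := by
    intro a b
    rw [← mem_convexHull_triangle_iff hK hM ht, RT]
    have hK' : (K : ℝ) ≠ 0 := by exact_mod_cast hK.ne'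
    have ht' : (M : ℝ) + N + t = K * M := by exact_mod_cast ht
    have : (M : ℝ) - (M + N) / K = t / K := by
      field_simp
      linarith
    simp [this]
  constructor
  · rintro ⟨h1, h2, h3⟩
    exact ⟨h2, h3, fun d hd => (hRT _ _).mp (h1 d hd)⟩
  · rintro ⟨h1, h2, h3⟩
    exact ⟨fun d hd => (hRT _ _).mpr (h3 d hd), h1, h2⟩

theorem X_pow_mul_sub_one_pow (a b : ℕ) :
    (X 0 ^ a * (X 1 - 1) ^ b : MvPolynomial (Fin 2) k) =
      ∑ i ∈ Finset.range (b + 1), monomial (Finsupp.single 0 a + Finsupp.single 1 i)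
        ((-1) ^ (b - i) * (b.choose i : k)) := by
  rw [sub_eq_add_neg, add_pow, Finset.mul_sum]
  refine Finset.sum_congr rfl fun i _ => ?_
  have : ((-1) ^ (b - i) * (b.choose i : MvPolynomial (Fin 2) k))
      = C ((-1) ^ (b - i) * (b.choose i : k)) := by simp
  rw [mul_assoc (X 1 ^ i), this, X_pow_eq_monomial, X_pow_eq_monomial, ← mul_assoc, monomial_mul,
    mul_comm, C_mul_monomial]
  simp

theorem coeff_X_pow_mul_sub_one_pow_self (a b : ℕ) :
    coeff (Finsupp.single 0 a + Finsupp.single 1 b)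
      (X 0 ^ a * (X 1 - 1) ^ b : MvPolynomial (Fin 2) k) = 1 := by
  classical
  rw [X_pow_mul_sub_one_pow, coeff_sum, Finset.sum_eq_single b]
  · simp
  · intro i _ hi
    rw [coeff_monomial, if_neg]
    intro h
    apply hi
    simpa using DFunLike.congr_fun h 1
  · simp

theorem mem_support_X_pow_mul_sub_one_pow {a b : ℕ} {d : Fin 2 →₀ ℕ}
    (hd : coeff d (X 0 ^ a * (X 1 - 1) ^ b : MvPolynomial (Fin 2) k) ≠ 0) :
    d 0 = a ∧ d 1 ≤ b := by
  classical
  rw [X_pow_mul_sub_one_pow, coeff_sum] at hd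
  obtain ⟨i, hi, h⟩ := Finset.exists_ne_zero_of_sum_ne_zero hd
  rw [coeff_monomial] at h
  have hid : Finsupp.single 0 a + Finsupp.single 1 i = d := by
    by_contra hne
    exact h (if_neg hne)
  rw [← hid]
  simpa using Nat.lt_succ_iff.mp (Finset.mem_range.mp hi)

theorem vanishesToOrder_sub_one_pow (b : ℕ) :
    VanishesToOrder b ((X 1 - 1) ^ b : MvPolynomial (Fin 2) k) := by
  have h1 : VanishesToOrder 1 (X 1 - 1 : MvPolynomial (Fin 2) k) := by
    intro d hd
    have : d = 0 := (Finsupp.degree_eq_zero_iff d).mp (Nat.lt_one_iff.mp hd)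
    subst this
    simp
  simpa using h1.pow b

/-- Consider the integer-valued form `p b - q a`. On the first triangle it is at most `a / m₁`, so
it is at most `1` and positive only on the edge `a = m₁`, at the corner; on the second it is at most
`-a' / m₂`, hence at most `-1` once `a' > 0`. A sum is therefore positive only for the corner plus
the origin. -/
theorem inTriangle_add_or_corner {K m₁ s₁ t₁ m₂ s₂ t₂ p q r : ℕ} (hm₁ : 0 < m₁) (hm₂ : 0 < m₂)
    (hp : 0 < p) (h₁ : p * s₁ = q * m₁ + 1) (h₂ : p * s₂ + 1 = q * m₂) (hr : m₁ + m₂ = r * p)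
    {a b a' b' : ℕ} (h : InTriangle K m₁ s₁ t₁ a b) (h' : InTriangle K m₂ s₂ t₂ a' b') :
    (a = m₁ ∧ b = s₁ ∧ a' = 0 ∧ b' = 0) ∨
      InTriangle K (m₁ + m₂) (r * q) (t₁ + t₂) (a + a') (b + b') := by
  obtain ⟨ha, hb, hK⟩ := h
  obtain ⟨ha', hb', hK'⟩ := h'
  suffices hpq : (a = m₁ ∧ b = s₁ ∧ a' = 0 ∧ b' = 0) ∨ p * (b + b') ≤ q * (a + a') by
    refine hpq.imp_right fun hpq => ⟨by omega, ?_, ?_⟩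
    · rw [hr, mul_assoc, mul_assoc]
      exact Nat.mul_le_mul_left r hpq
    · rw [mul_add]
      omega
  zify at *
  have hu : (m₁ : ℤ) * (p * b - q * a) ≤ a := by nlinarith
  have hw : (m₂ : ℤ) * (p * b' - q * a') ≤ -a' := by nlinarith
  have hu1 : (p * b - q * a : ℤ) ≤ 1 := by
    by_contra hlt
    nlinarith
  rcases (Int.natCast_nonneg a').eq_or_lt with h0 | h0
  · have hb0 : (b' : ℤ) = 0 := by
      rw [← h0, mul_zero] at hb'
      exact le_antisymm (nonpos_of_mul_nonpos_right hb' hm₂) (Int.natCast_nonneg _)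
    rcases ha.eq_or_lt with ham | ham
    · have hbs : (b : ℤ) ≤ s₁ := by
        rw [ham, mul_comm (s₁ : ℤ)] at hb
        exact le_of_mul_le_mul_left hb hm₁
      rcases hbs.eq_or_lt with hbs | hbs
      · exact Or.inl ⟨ham, hbs, h0.symm, hb0⟩
      · right
        rw [hb0, ← h0, ham]
        nlinarith
    · right
      have : (p * b - q * a : ℤ) ≤ 0 := by
        by_contra hlt
        nlinarith
      rw [hb0, ← h0]
      linarith
  · right
    have : (p * b' - q * a' : ℤ) ≤ -1 := by
      by_contra hlt
      nlinarith
    linarith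

/-- The product of the curves of two triangles whose slopes are the neighbours of `q / p` has only
one monomial above the line of slope `q / p`, and subtracting a multiple of `x ^ a (y - 1) ^ b`
removes it. -/
theorem IsTriangleCurve.mul_sub_corner {K m₁ s₁ t₁ m₂ s₂ t₂ p q r : ℕ} (hm₁ : 0 < m₁)
    (hm₂ : 0 < m₂) (hp : 0 < p) (hr0 : 0 < r) (h₁ : p * s₁ = q * m₁ + 1)
    (h₂ : p * s₂ + 1 = q * m₂) (hr : m₁ + m₂ = r * p) (ht : K * m₁ ≤ t₁ + t₂)
    (hs : m₁ + m₂ ≤ s₁) {f g : MvPolynomial (Fin 2) k}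
    (hf : IsTriangleCurve K m₁ s₁ t₁ f) (hg : IsTriangleCurve K m₂ s₂ t₂ g) :
    IsTriangleCurve K (m₁ + m₂) (r * q) (t₁ + t₂)
      (f * g - C (coeff (Finsupp.single 0 m₁ + Finsupp.single 1 s₁) f) * X 0 ^ m₁
        * (X 1 - 1) ^ s₁) := by
  classical
  set c : Fin 2 →₀ ℕ := Finsupp.single 0 m₁ + Finsupp.single 1 s₁ with hc
  have hc0 : c 0 = m₁ := by simp [hc]
  have hc1 : c 1 = s₁ := by simp [hc]
  have hcT : ¬ InTriangle K (m₁ + m₂) (r * q) (t₁ + t₂) (c 0) (c 1) := by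
    rintro ⟨-, h, -⟩
    rw [hc0, hc1, hr, mul_assoc, mul_assoc, h₁] at h
    have := le_of_mul_le_mul_left h hr0
    omega
  have hdich : ∀ d ∈ f.support, ∀ e ∈ g.support, (d = c ∧ e = 0) ∨
      InTriangle K (m₁ + m₂) (r * q) (t₁ + t₂) ((d + e) 0) ((d + e) 1) := by
    intro d hd e he
    refine (inTriangle_add_or_corner hm₁ hm₂ hp h₁ h₂ hr (hf.supported d hd)
      (hg.supported e he)).imp_left ?_
    rintro ⟨h1, h2, h3, h4⟩
    rw [eq_single_add_single d, eq_single_add_single e, h1, h2, h3, h4]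
    simp [hc]
  have hfg : ∀ d ∈ (f * g).support,
      d = c ∨ InTriangle K (m₁ + m₂) (r * q) (t₁ + t₂) (d 0) (d 1) := by
    intro d hd
    obtain ⟨x, hx, y, hy, rfl⟩ := Finset.mem_add.mp (support_mul f g hd)
    rcases hdich x hx y hy with ⟨rfl, rfl⟩ | h
    · exact Or.inl (add_zero _)
    · exact Or.inr h
  have hcoeff : coeff c (f * g) = coeff c f := by
    rw [coeff_mul, Finset.sum_eq_single (c, 0), hg.constantTerm, mul_one]
    · rintro ⟨d, e⟩ hde hne
      rw [Finset.HasAntidiagonal.mem_antidiagonal] at hde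
      by_contra h
      rcases hdich d (mem_support_iff.mpr (left_ne_zero_of_mul h)) e
        (mem_support_iff.mpr (right_ne_zero_of_mul h)) with ⟨rfl, rfl⟩ | h'
      · exact hne rfl
      · dsimp only at hde
        rw [hde] at h'
        exact hcT h'
    · simp
  rw [mul_assoc]
  refine ⟨(hf.vanishes.mul hg.vanishes).sub ?_, ?_, ?_⟩
  · have := (vanishesToOrder_zero (C (coeff c f) : MvPolynomial (Fin 2) k)).mul
      ((vanishesToOrder_zero (X 0 ^ m₁ : MvPolynomial (Fin 2) k)).mul
        (vanishesToOrder_sub_one_pow s₁))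
    exact this.mono (by omega)
  · have h0 : coeff 0 (X 0 ^ m₁ * (X 1 - 1) ^ s₁ : MvPolynomial (Fin 2) k) = 0 := by
      by_contra h
      exact hm₁.ne (mem_support_X_pow_mul_sub_one_pow h).1
    have h1 : coeff 0 (f * g) = 1 := by
      rw [← constantCoeff_eq, map_mul, constantCoeff_eq, hf.constantTerm, hg.constantTerm, one_mul]
    rw [coeff_sub, coeff_C_mul, h0, h1, mul_zero, sub_zero]
  · intro d hd
    rw [mem_support_iff, coeff_sub, coeff_C_mul] at hd
    have hdc : d ≠ c := by
      rintro rfl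
      rw [hcoeff, coeff_X_pow_mul_sub_one_pow_self, mul_one, sub_self] at hd
      exact hd rfl
    by_cases h : coeff d (f * g) = 0
    · rw [h, zero_sub, neg_ne_zero] at hd
      obtain ⟨h0, h1⟩ := mem_support_X_pow_mul_sub_one_pow (right_ne_zero_of_mul hd)
      have h1' : d 1 < s₁ := by
        refine lt_of_le_of_ne h1 fun h1 => hdc ?_
        rw [eq_single_add_single d, h0, h1]
      refine ⟨by omega, ?_, by rw [h0]; omega⟩
      -- The corner exceeds the line of slope `q / p` by only `1` in the form `p b - q a`, so a step
      -- down by one in its column, which lowers the form by `p ≥ 1`, already lands in the triangle.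
      rw [hr, h0, mul_assoc, mul_assoc]
      refine Nat.mul_le_mul_left r ?_
      have : p * (d 1 + 1) ≤ p * s₁ := Nat.mul_le_mul_left p h1'
      rw [mul_add] at this
      omega
    · exact (hfg d (mem_support_iff.mpr h)).resolve_left hdc

theorem IsTriangleCurve.pow {K m s t : ℕ} {f : MvPolynomial (Fin 2) k}
    (hf : IsTriangleCurve K m s t f) (n : ℕ) :
    IsTriangleCurve K (n * m) (n * s) (n * t) (f ^ n) := by
  classical
  refine ⟨hf.vanishes.pow n, ?_, ?_⟩
  · rw [← constantCoeff_eq, map_pow, constantCoeff_eq, hf.constantTerm, one_pow]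
  · have key : ∀ d ∈ (f ^ n).support, d 0 ≤ n * m ∧ m * d 1 ≤ s * d 0 ∧ K * d 0 ≤ n * t + d 1 := by
      induction n with
      | zero =>
        intro d hd
        have : d = 0 := by
          by_contra h
          rw [pow_zero, mem_support_iff, coeff_one, if_neg (Ne.symm h)] at hd
          exact hd rfl
        subst this
        simp
      | succ n ih =>
        intro d hd
        rw [pow_succ] at hd
        obtain ⟨x, hx, y, hy, rfl⟩ := Finset.mem_add.mp (support_mul _ _ hd)
        obtain ⟨h1, h2, h3⟩ := ih x hx
        obtain ⟨h1', h2', h3'⟩ := hf.supported y hy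
        simp only [Finsupp.add_apply, mul_add, add_mul, one_mul]
        omega
    intro d hd
    obtain ⟨h1, h2, h3⟩ := key d hd
    refine ⟨h1, ?_, h3⟩
    rw [mul_assoc, mul_assoc]
    exact Nat.mul_le_mul_left n h2

end Curves

/-! ### Arithmetic of `(M+N)² = KMN + 1` -/

namespace IsSolution

variable {K M N : ℕ}

theorem eq_one_of_eq_zero (h : IsSolution K M 0) : M = 1 := by
  simpa [IsSolution] using h

theorem symm (h : IsSolution K M N) : IsSolution K N M := by
  unfold IsSolution at *
  rw [add_comm, h]
  ring

theorem add_pos (h : IsSolution K M N) : 0 < M + N := by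
  unfold IsSolution at h
  by_contra h0
  have : M + N = 0 := by omega
  rw [this] at h
  simp at h

/-- This is nonnegativity of the second coordinate of `τ(M,N)`. If it failed, the equation would
force `N² + M ≤ 1`, leaving only `(0,1)`, which is excluded by `K ≥ 3`. -/
theorem add_two_mul_le (hK : 3 ≤ K) (h : IsSolution K M N) (hN : 0 < N) : M + 2 * N ≤ K * N := by
  unfold IsSolution at h
  by_contra hlt
  have h1 : K * N + 1 ≤ M + 2 * N := by omega
  have h2 : (K * N + 1) * M ≤ (M + 2 * N) * M := Nat.mul_le_mul_right M h1
  have h3 : N ^ 2 + M ≤ 1 := by nlinarith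
  have h4 : N = 1 ∧ M = 0 := by
    have : N ≤ N ^ 2 := Nat.le_self_pow two_ne_zero N
    omega
  obtain ⟨rfl, rfl⟩ := h4
  omega

theorem isBalanced_int (hK : 3 ≤ K) (h : IsSolution K M N) :
    IsBalanced K (M + N) (K * N) (K * M) := by
  refine ⟨h.add_pos, by ring, ?_, 1, K, one_dvd _, one_dvd _, one_dvd _, by omega, by omega, ?_⟩
  · rcases Nat.eq_zero_or_pos N with rfl | hN
    · exact Or.inl h.eq_one_of_eq_zero
    · rcases Nat.eq_zero_or_pos M with rfl | hM
      · left
        rw [zero_add]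
        exact h.symm.eq_one_of_eq_zero
      · have := h.add_two_mul_le hK hN
        have := h.symm.add_two_mul_le hK hM
        exact Or.inr ⟨by omega, by omega⟩
  · rw [show (M + N) ^ 2 = K * M * N + 1 from h]
    ring

theorem rat_defect {t : ℕ} (h : IsSolution K M N) (ht : M + N + t = K * M) :
    (M + N) * t + 1 = K * M ^ 2 := by
  unfold IsSolution at h
  have : (M + N) * (M + N + t) = (M + N) * (K * M) := by rw [ht]
  nlinarith

theorem isBalanced_rat {t : ℕ} (hK : 3 ≤ K) (h : IsSolution K M N) (hM : 0 < M)
    (ht : M + N + t = K * M) : IsBalanced K M (M + N) t := by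
  have := h.symm.add_two_mul_le hK hM
  exact ⟨hM, ht, Or.inr ⟨by omega, by omega⟩, 1, 1, one_dvd _, one_dvd _, one_dvd _, one_pos,
    by omega, h.rat_defect ht⟩

/-- Scaling by `K` turns the defect `1` of the rational triangle into `K²`, exactly the bound `K c`
for the common divisor `c = K`. Uniqueness thus holds for the triangle containing the `K`-th power
in relation (2). -/
theorem isBalanced_mul_rat {t : ℕ} (hK : 3 ≤ K) (h : IsSolution K M N) (hM : 0 < M)
    (ht : M + N + t = K * M) : IsBalanced K (K * M) (K * (M + N)) (K * t) := by
  have := h.symm.add_two_mul_le hK hM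
  refine ⟨by positivity, by rw [← mul_add, ht], Or.inr ⟨?_, ?_⟩, K, K * K, dvd_mul_right _ _,
    dvd_mul_right _ _, dvd_mul_right _ _, by positivity, le_rfl, ?_⟩
  · exact Nat.mul_le_mul_left K (by omega)
  · exact Nat.mul_le_mul_left K (by omega)
  · have := h.rat_defect ht
    calc K * (M + N) * (K * t) + K * K = K * K * ((M + N) * t + 1) := by ring
      _ = K * (K * M) ^ 2 := by rw [this]; ring

/-- For `N > 0`, the transformation `tau` maps solutions to solutions. -/
theorem exists_tau (hK : 3 ≤ K) (h : IsSolution K M N) (hN : 0 < N) :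
    ∃ N' : ℕ, M + N' + 2 * N = K * N ∧ tau K (M, N) = ((N : ℤ), (N' : ℤ)) ∧
      N ^ 2 = M * N' + 1 ∧ IsSolution K N N' := by
  obtain ⟨N', hN'⟩ := Nat.exists_eq_add_of_le (h.add_two_mul_le hK hN)
  -- Vieta: for fixed `N` the equation is quadratic in `M`, and `N'` is its other root, with root
  -- sum `(K - 2) N` and product `N² - 1`.
  have hsq : N ^ 2 = M * N' + 1 := by
    unfold IsSolution at h
    have : K * M * N = (M + 2 * N + N') * M := by rw [← hN']; ring
    nlinarith
  refine ⟨N', by omega, ?_, hsq, ?_⟩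
  · have : (K : ℤ) * N = M + 2 * N + N' := by exact_mod_cast hN'
    simp only [tau, Prod.mk.injEq, true_and]
    linarith
  · unfold IsSolution
    have : K * N * N' = (M + 2 * N + N') * N' := by rw [← hN']
    nlinarith

end IsSolution

/-! ### The two relations and the recursion -/

section Relations

variable {k : Type*} [Field k] {K M N : ℕ}

theorem isXiInt_xiInt (h : ∃! f : MvPolynomial (Fin 2) k, IsXiInt K (M, N) f) :
    IsXiInt K (M, N) (xiInt k K (M, N)) :=
  Classical.epsilon_spec h.exists

theorem isXiRat_xiRat (h : ∃! f : MvPolynomial (Fin 2) k, IsXiRat K (M, N) f) :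
    IsXiRat K (M, N) (xiRat k K (M, N)) :=
  Classical.epsilon_spec h.exists

/-- The pair `(0,-1) = τ(1,0)` lies outside the range of solutions in natural numbers. Its triangle
has the origin as its only lattice point with nonnegative coordinates, and no vanishing is imposed.
-/
theorem isXiRat_zero_neg_one_iff (hK : 3 ≤ K) {f : MvPolynomial (Fin 2) k} :
    IsXiRat K (0, -1) f ↔ f = 1 := by
  classical
  constructor
  · rintro ⟨h1, -, h3⟩
    have hK' : (3 : ℝ) ≤ K := by exact_mod_cast hK
    have hsub : RT K (0, -1) ⊆ {p : ℝ × ℝ | p.1 ≤ 1 / K} ∩ {p : ℝ × ℝ | p.2 ≤ 0} := by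
      refine convexHull_min ?_ ((convex_halfSpace_le (LinearMap.fst ℝ ℝ ℝ).isLinear _).inter
        (convex_halfSpace_le (LinearMap.snd ℝ ℝ ℝ).isLinear _))
      rintro p (rfl | rfl | rfl) <;> simp [neg_div]
    ext d
    rw [coeff_one]
    split_ifs with hd
    · rw [← hd, h3]
    · by_contra hne
      obtain ⟨hx, hy⟩ := hsub (h1 d (mem_support_iff.mpr hne))
      apply hd
      have hx' : (d 0 : ℝ) < 1 := by
        refine lt_of_le_of_lt hx ?_
        rw [div_lt_one (by linarith)]
        linarith
      have hx0 : d 0 < 1 := by exact_mod_cast hx'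
      have hy0 : d 1 ≤ 0 := by exact_mod_cast (show (d 1 : ℝ) ≤ 0 from hy)
      rw [eq_single_add_single d, Nat.lt_one_iff.mp hx0, Nat.le_zero.mp hy0]
      simp
  · rintro rfl
    refine ⟨?_, vanishesToOrder_zero _, coeff_zero_one⟩
    intro d hd
    have : d = 0 := by
      by_contra h
      rw [mem_support_iff, coeff_one, if_neg (Ne.symm h)] at hd
      exact hd rfl
    subst this
    exact subset_convexHull _ _ (by simp)

theorem xiRat_zero_neg_one (hK : 3 ≤ K) : xiRat k K (0, -1) = 1 :=
  (isXiRat_zero_neg_one_iff hK).mp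
    (Classical.epsilon_spec (p := IsXiRat K (0, -1)) ⟨1, (isXiRat_zero_neg_one_iff hK).mpr rfl⟩)

theorem IsTriangleCurve.ne_zero {m s t : ℕ} {f : MvPolynomial (Fin 2) k}
    (h : IsTriangleCurve K m s t f) : f ≠ 0 := by
  rintro rfl
  simpa using h.constantTerm

variable [CharZero k]

theorem existsUnique_isXiInt (hK : 3 ≤ K) (h : IsSolution K M N) :
    ∃! f : MvPolynomial (Fin 2) k, IsXiInt K (M, N) f := by
  simp only [isXiInt_iff (by omega : 0 < K) h.add_pos]
  exact (h.isBalanced_int hK).existsUnique_curve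

theorem existsUnique_isXiRat (hK : 3 ≤ K) (h : IsSolution K M N) (hM : 0 < M) :
    ∃! f : MvPolynomial (Fin 2) k, IsXiRat K (M, N) f := by
  have := h.symm.add_two_mul_le hK hM
  have ht : M + N + (K * M - (M + N)) = K * M := by omega
  simp only [isXiRat_iff (by omega : 0 < K) hM ht]
  exact (h.isBalanced_rat hK hM ht).existsUnique_curve

theorem isTriangleCurve_xiInt (hK : 3 ≤ K) (h : IsSolution K M N) :
    IsTriangleCurve K (M + N) (K * N) (K * M) (xiInt k K (M, N)) :=
  (isXiInt_iff (by omega) h.add_pos).mp (isXiInt_xiInt (existsUnique_isXiInt hK h))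

theorem isTriangleCurve_xiRat {t : ℕ} (hK : 3 ≤ K) (h : IsSolution K M N) (hM : 0 < M)
    (ht : M + N + t = K * M) : IsTriangleCurve K M (M + N) t (xiRat k K (M, N)) :=
  (isXiRat_iff (by omega) hM ht).mp (isXiRat_xiRat (existsUnique_isXiRat hK h hM))

theorem xiInt_one_zero (hK : 3 ≤ K) : xiInt k K (1, 0) = 1 - X 0 := by
  have hsol : IsSolution K 1 0 := by simp [IsSolution]
  have hcurve : IsTriangleCurve K (1 + 0) (K * 0) (K * 1) (1 - X 0 : MvPolynomial (Fin 2) k) := by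
    classical
    refine ⟨?_, ?_, ?_⟩
    · intro d hd
      have : d = 0 := (Finsupp.degree_eq_zero_iff d).mp (Nat.lt_one_iff.mp hd)
      subst this
      simp
    · simp
    · intro d hd
      rw [mem_support_iff, coeff_sub, coeff_one, coeff_X] at hd
      rcases eq_or_ne d 0 with rfl | h0
      · simp [InTriangle]
      · have h1 : Finsupp.single 0 1 = d := by
          by_contra h1
          rw [if_neg (Ne.symm h0), if_neg h1, sub_zero] at hd
          exact hd rfl
        rw [← h1]
        simp [InTriangle]
  exact (hsol.isBalanced_int hK).existsUnique_curve.unique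
    (by simpa using isTriangleCurve_xiInt (k := k) hK hsol) hcurve

theorem xiRat_one_zero (hK : 3 ≤ K) : xiRat k K (1, 0) = 1 - X 0 * X 1 := by
  have hsol : IsSolution K 1 0 := by simp [IsSolution]
  have ht : 1 + 0 + (K - 1) = K * 1 := by omega
  have hmon : (X 0 * X 1 : MvPolynomial (Fin 2) k)
      = monomial (Finsupp.single 0 1 + Finsupp.single 1 1) 1 := by
    rw [X, X, monomial_mul, one_mul]
  have hcurve : IsTriangleCurve K 1 (1 + 0) (K - 1)
      (1 - X 0 * X 1 : MvPolynomial (Fin 2) k) := by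
    classical
    refine ⟨?_, ?_, ?_⟩
    · intro d hd
      have : d = 0 := (Finsupp.degree_eq_zero_iff d).mp (Nat.lt_one_iff.mp hd)
      subst this
      simp [← constantCoeff_eq]
    · simp [← constantCoeff_eq]
    · intro d hd
      rw [mem_support_iff, coeff_sub, coeff_one, hmon, coeff_monomial] at hd
      rcases eq_or_ne d 0 with rfl | h0
      · simp [InTriangle]
      · have h1 : Finsupp.single 0 1 + Finsupp.single 1 1 = d := by
          by_contra h1
          rw [if_neg (Ne.symm h0), if_neg h1, sub_zero] at hd
          exact hd rfl
        rw [← h1]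
        simp [InTriangle]
        omega
  exact (hsol.isBalanced_rat hK one_pos ht).existsUnique_curve.unique
    (by simpa using isTriangleCurve_xiRat (k := k) hK hsol one_pos ht) hcurve

theorem epsRat_one_zero (hK : 3 ≤ K) : epsRat k K 1 0 = -1 := by
  classical
  have hmon : (X 0 * X 1 : MvPolynomial (Fin 2) k)
      = monomial (Finsupp.single 0 1 + Finsupp.single 1 1) 1 := by
    rw [X, X, monomial_mul, one_mul]
  have h0 : (0 : Fin 2 →₀ ℕ) ≠ Finsupp.single 0 1 + Finsupp.single 1 1 := by
    intro h
    simpa using DFunLike.congr_fun h 0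
  have := xiRat_one_zero (k := k) hK
  simp only [epsRat, Nat.cast_one, Nat.cast_zero, this, hmon, coeff_sub, coeff_one, coeff_monomial,
    add_zero, if_neg h0, if_true, zero_sub]

theorem xiInt_eq (hK : 3 ≤ K) (h : IsSolution K M N) (hM : 0 < M) :
    xiInt k K (M, N) = xiRat k K (M, N) * xiRat k K (tau K (M, N))
      - C (epsRat k K M N) * X 0 ^ M * (X 1 - 1) ^ (M + N) := by
  -- For `(1,0)` the second factor is `1`, and the relation reads `1 - x = (1 - xy) + x(y - 1)`.
  rcases Nat.eq_zero_or_pos N with rfl | hN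
  · obtain rfl := h.eq_one_of_eq_zero
    have htau : tau K ((1 : ℕ), (0 : ℕ)) = (0, -1) := by simp [tau]
    rw [htau, xiRat_zero_neg_one hK, epsRat_one_zero hK, Nat.cast_one, Nat.cast_zero,
      xiInt_one_zero hK, xiRat_one_zero hK, C_neg, C_1]
    ring
  · obtain ⟨N', hN', htau, hsq, hsol⟩ := h.exists_tau hK hN
    have hle := h.symm.add_two_mul_le hK hM
    obtain ⟨t, ht⟩ := Nat.exists_eq_add_of_le (show M + N ≤ K * M by omega)
    have ht' : N + N' + (M + N) = K * N := by omega
    have hsol' : (M + N) ^ 2 = K * M * N + 1 := h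
    have hdef := hsol.rat_defect ht'
    rw [htau]
    -- The target slope is that of `IT(M,N)`, namely `KN / (M+N)`; the neighbour conditions are the
    -- equation itself and `rat_defect` for `τ(M,N)`.
    have hcurve := IsTriangleCurve.mul_sub_corner (p := M + N) (q := K * N) (r := 1) hM hN
      h.add_pos one_pos (by rw [← sq, hsol']; ring) (by rw [mul_comm, hdef]; ring) (by ring)
      (by omega) le_rfl (isTriangleCurve_xiRat (k := k) hK h hM ht.symm)
      (isTriangleCurve_xiRat (k := k) hK hsol hN ht')
    rw [one_mul, show t + (M + N) = K * M by omega] at hcurve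
    exact (h.isBalanced_int hK).existsUnique_curve.unique (isTriangleCurve_xiInt hK h) hcurve

theorem xiRat_tau_pow_eq (hK : 3 ≤ K) (h : IsSolution K M N) (hN : 0 < N) :
    xiRat k K (tau K (M, N)) ^ K = xiInt k K (M, N) * xiInt k K (tau K (M, N))
      - C (epsInt k K M N) * X 0 ^ (M + N) * (X 1 - 1) ^ (K * N) := by
  obtain ⟨N', hN', htau, hsq, hsol⟩ := h.exists_tau hK hN
  have ht' : N + N' + (M + N) = K * N := by omega
  have hsol' : (N + N') ^ 2 = K * N * N' + 1 := hsol
  have hdef := hsol.rat_defect ht'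
  rw [htau]
  -- The target is `K` times the rational triangle of `τ(M,N) = (N,N')`, of slope `(N+N')/N`; its
  -- width is `(M+N) + (N+N') = K N`. The power and the corrected product are both solutions there.
  have hcurve := IsTriangleCurve.mul_sub_corner (p := N) (q := N + N') (r := K) h.add_pos
    hsol.add_pos hN (by omega) (by rw [hdef]; ring) (by rw [← sq, hsol']; ring) (by omega)
    (by rw [mul_add]) (by omega) (isTriangleCurve_xiInt (k := k) hK h)
    (isTriangleCurve_xiInt (k := k) hK hsol)
  rw [show M + N + (N + N') = K * N by omega, ← mul_add] at hcurve
  exact (hsol.isBalanced_mul_rat hK hN ht').existsUnique_curve.unique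
    ((isTriangleCurve_xiRat (k := k) hK hsol hN ht').pow K) hcurve

/-- With both polynomials for `τ(M,N)` known, (2) determines `F` at `(M,N)` after cancelling the
integral polynomial of `τ(M,N)`; then (1) determines `G` after cancelling the rational one. -/
theorem eq_xi_of_relations (hK : 3 ≤ K) {F G : ℤ × ℤ → MvPolynomial (Fin 2) k}
    (hF : F (1, 0) = 1 - X 0) (hG : G (1, 0) = 1 - X 0 * X 1)
    (hrel : ∀ M N : ℕ, IsSolution K M N → 0 < N → N < M →
      F (M, N) = G (M, N) * G (tau K (M, N))
        - C (epsRat k K M N) * X 0 ^ M * (X 1 - 1) ^ (M + N) ∧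
      G (tau K (M, N)) ^ K = F (M, N) * F (tau K (M, N))
        - C (epsInt k K M N) * X 0 ^ (M + N) * (X 1 - 1) ^ (K * N))
    (M N : ℕ) (h : IsSolution K M N) (hlt : N < M) :
    F (M, N) = xiInt k K (M, N) ∧ G (M, N) = xiRat k K (M, N) := by
  induction N using Nat.strong_induction_on generalizing M with
  | _ N ih =>
  rcases Nat.eq_zero_or_pos N with rfl | hN
  · obtain rfl := h.eq_one_of_eq_zero
    rw [Nat.cast_one, Nat.cast_zero, hF, hG, xiInt_one_zero hK, xiRat_one_zero hK]
    exact ⟨rfl, rfl⟩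
  · obtain ⟨N', hN', htau, hsq, hsol⟩ := h.exists_tau hK hN
    -- Since `M N' = N² - 1` and `M > N`, the other root satisfies `N' < N`; the same inequality
    -- keeps `τ(M,N)` in the range where the first coordinate is larger.
    have hN'N : N' < N := by
      by_contra hge
      have : N * N ≤ M * N' := Nat.mul_le_mul hlt.le (by omega)
      have : M * N' + 1 = N * N := by rw [← hsq, sq]
      omega
    obtain ⟨hFτ, hGτ⟩ := ih N' hN'N N hsol hN'N
    obtain ⟨r1, r2⟩ := hrel M N h hN hlt
    have x1 := xiInt_eq (k := k) hK h (by omega)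
    have x2 := xiRat_tau_pow_eq (k := k) hK h hN
    rw [htau, hGτ] at r1 r2
    rw [hFτ] at r2
    rw [htau] at x1 x2
    have hFeq : F (M, N) = xiInt k K (M, N) := by
      refine mul_right_cancel₀ (isTriangleCurve_xiInt (k := k) hK hsol).ne_zero ?_
      exact sub_left_injective (r2.symm.trans x2)
    refine ⟨hFeq, ?_⟩
    have ht' : N + N' + (M + N) = K * N := by omega
    refine mul_right_cancel₀ (isTriangleCurve_xiRat (k := k) hK hsol hN ht').ne_zero ?_
    exact sub_left_injective (r1.symm.trans (hFeq.trans x1))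

end Relations

theorem lemma6p1 (k : Type*) [Field k] [CharZero k] (K : ℕ) (hK : 3 ≤ K) :
    -- the polynomials are well defined and satisfy the two relations
    (∀ M N : ℕ, IsSolution K M N →
      (0 < M →
        (∃! f : MvPolynomial (Fin 2) k, IsXiInt K (M, N) f) ∧
        (∃! f : MvPolynomial (Fin 2) k, IsXiRat K (M, N) f) ∧
        (∃! f : MvPolynomial (Fin 2) k, IsXiRat K (tau K (M, N)) f) ∧
        xiInt k K (M, N) = xiRat k K (M, N) * xiRat k K (tau K (M, N))
          - C (epsRat k K M N) * X 0 ^ M * (X 1 - 1) ^ (M + N)) ∧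
      (0 < N →
        (∃! f : MvPolynomial (Fin 2) k, IsXiInt K (M, N) f) ∧
        (∃! f : MvPolynomial (Fin 2) k, IsXiInt K (tau K (M, N)) f) ∧
        (∃! f : MvPolynomial (Fin 2) k, IsXiRat K (tau K (M, N)) f) ∧
        xiRat k K (tau K (M, N)) ^ K = xiInt k K (M, N) * xiInt k K (tau K (M, N))
          - C (epsInt k K M N) * X 0 ^ (M + N) * (X 1 - 1) ^ (K * N))) ∧
    -- given the coefficients `ε`, the relations determine all polynomials with `M > N`
    -- inductively from the ones for `(1,0)`
    xiInt k K (1, 0) = 1 - X 0 ∧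
    xiRat k K (1, 0) = 1 - X 0 * X 1 ∧
    (∀ F G : ℤ × ℤ → MvPolynomial (Fin 2) k,
      F (1, 0) = 1 - X 0 →
      G (1, 0) = 1 - X 0 * X 1 →
      (∀ M N : ℕ, IsSolution K M N → 0 < N → N < M →
        F (M, N) = G (M, N) * G (tau K (M, N))
          - C (epsRat k K M N) * X 0 ^ M * (X 1 - 1) ^ (M + N) ∧
        G (tau K (M, N)) ^ K = F (M, N) * F (tau K (M, N))
          - C (epsInt k K M N) * X 0 ^ (M + N) * (X 1 - 1) ^ (K * N)) →
      ∀ M N : ℕ, IsSolution K M N → N < M →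
        F (M, N) = xiInt k K (M, N) ∧ G (M, N) = xiRat k K (M, N)) := by
  refine ⟨fun M N h => ⟨fun hM => ⟨existsUnique_isXiInt hK h, existsUnique_isXiRat hK h hM, ?_,
      xiInt_eq hK h hM⟩, fun hN => ?_⟩, xiInt_one_zero hK, xiRat_one_zero hK,
    fun F G hF hG hrel => eq_xi_of_relations hK hF hG hrel⟩
  · rcases Nat.eq_zero_or_pos N with rfl | hN
    · obtain rfl := h.eq_one_of_eq_zero
      have htau : tau K ((1 : ℕ), (0 : ℕ)) = (0, -1) := by simp [tau]
      rw [htau]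
      simp only [isXiRat_zero_neg_one_iff hK]
      exact existsUnique_eq
    · obtain ⟨N', -, htau, -, hsol⟩ := h.exists_tau hK hN
      rw [htau]
      exact existsUnique_isXiRat hK hsol hN
  · obtain ⟨N', -, htau, -, hsol⟩ := h.exists_tau hK hN
    refine ⟨existsUnique_isXiInt hK h, ?_, ?_, xiRat_tau_pow_eq hK h hN⟩
    · rw [htau]
      exact existsUnique_isXiInt hK hsol
    · rw [htau]
      exact existsUnique_isXiRat hK hsol hN
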